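/- Fix $d\in\mathbb N$ and a set $F\subseteq\{0,1\}^d$ of admissible feature vectors (for instance the one-hot vectors, the one-hot vectors together with $0$, or all of $\{0,1\}^d$). A featured graph is $G=(V,E,f)$ with $V$ finite and non-empty, $E\subseteq V\times V$ (directed edges; loops allowed) and $f\colon V\to F$. Write $N_{\mathrm{out}}(v)=\{u\in V\mid (v,u)\in E\}$. An ACR-GNN $\mathcal N$ with input dimension $d$ and $L\in\mathbb N$ layers consists of dimensions $d_0=d,d_1,\dots,d_L\in\mathbb N$, arbitrary functions $\mathsf{agg}_i,\mathsf{read}_i$ from finite multisets over $\mathbb R^{d_{i-1}}$ to $\mathbb R^{d_{i-1}}$ and $\mathsf{comb}_i\colon(\mathbb R^{d_{i-1}})^3\to\mathbb R^{d_i}$ for $1\le i\le L$, and a function $\mathsf{cls}\colon\mathbb R^{d_L}\to\{0,1\}$. On a featured graph $G$ it computes $f^{(0)}=f$ and $$f^{(i)}(v)=\mathsf{comb}_i\Big(f^{(i-1)}(v),\ \mathsf{agg}_i\big(\{\!\{f^{(i-1)}(u)\mid u\in N_{\mathrm{out}}(v)\}\!\}\big),\ \mathsf{read}_i\big(\{\!\{f^{(i-1)}(u)\mid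 u\in V\}\!\}\big)\Big),$$ and it accepts $(G,v)$ if $\mathsf{cls}(f^{(L)}(v))=1$. An aggregation function $\mathsf{agg}_i$ is bounded if there is $c\in\mathbb N$ such that $\mathsf{agg}_i(M)=\mathsf{agg}_i(M_{|c})$ for every $M$, where $M_{|c}$ is the multiset with multiplicities $M_{|c}(x)=\min(M(x),c)$. An FO classifier is a first-order formula with (at most) one free variable over the vocabulary with equality, a binary symbol for $E$, and $d$ unary symbols $p_1,\dots,p_d$, where $p_i(v)$ means $f(v)[i]=1$. The formulas of $\mathrm{GML}^\exists$ are given by $$\psi::=\top\mid p_i\mid\neg\psi\mid\psi\wedge\psi\mid\Diamond_{\ge k}\psi\mid\exists_{\ge k}\psi\qquad(1\le i\le d,\ k\in\mathbb N),$$ where $G,v\models\Diamond_{\ge k}\psi$ iff at least $k$ vertices $u\in N_{\mathrm{out}}(v)$ satisfy $\psi$, and $G,v\models\exists_{\ge k}\psi$ iff at least $k$ vertices $u\in V$ satisfy $\psi$. **Proposition.** For every FO classifier $\varphi$ the following are equivalent: 1. there is an ACR-GNN $\mathcal N$ with input dimension $d$, all of whose aggregation functions are bounded (the readout functions being arbitrary),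 that captures $\varphi$: for all featured graphs $G$ and all $v\in V$, $\mathcal N$ accepts $(G,v)$ iff $G,v\models\varphi$; 2. there is a $\mathrm{GML}^\exists$ formula $\psi$ equivalent to $\varphi$: for all featured graphs $G$ and all $v\in V$, $G,v\models\psi$ iff $G,v\models\varphi$. -/

import Mathlib

namespace ACR

/-! ### Multisets -/

open Classical in
/-- The `c`-restriction `M|_c` of a multiset: every multiplicity is cut off at `c`. -/
noncomputable def restrict {S : Type*} (c : ℕ) (M : Multiset S) : Multiset S :=
  M.dedup.bind fun x => Multiset.replicate (min (M.count x) c) x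

open Classical in
/-- The defining property `M|_c(x) = min(M(x), c)` of the `c`-restriction. -/
theorem count_restrict {S : Type*} (c : ℕ) (M : Multiset S) (x : S) :
    (restrict c M).count x = min (M.count x) c := by
  unfold restrict
  rw [Multiset.count_bind]
  simp only [Multiset.count_replicate]
  by_cases hx : x ∈ M
  · obtain ⟨t, ht⟩ := Multiset.exists_cons_of_mem (Multiset.mem_dedup.2 hx)
    have hnd : (x ::ₘ t).Nodup := ht ▸ Multiset.nodup_dedup M
    have hxt : x ∉ t := (Multiset.nodup_cons.1 hnd).1
    rw [ht, Multiset.map_cons, Multiset.sum_cons, if_pos rfl]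
    have h0 : (t.map fun a => if a = x then min (M.count a) c else 0).sum = 0 := by
      refine Multiset.sum_eq_zero fun n hn => ?_
      obtain ⟨a, ha, rfl⟩ := Multiset.mem_map.1 hn
      rw [if_neg]
      rintro rfl
      exact hxt ha
    omega
  · rw [Multiset.count_eq_zero_of_notMem hx, Nat.zero_min]
    refine Multiset.sum_eq_zero fun n hn => ?_
    obtain ⟨a, ha, rfl⟩ := Multiset.mem_map.1 hn
    rw [if_neg]
    rintro rfl
    exact hx (Multiset.mem_dedup.1 ha)

/-- A function on multisets is `c`-bounded if it depends only on the `c`-restriction. -/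
def IsBoundedBy {S T : Type*} (c : ℕ) (f : Multiset S → T) : Prop :=
  ∀ M : Multiset S, f M = f (restrict c M)

/-- A function on multisets is bounded if it is `c`-bounded for some `c`. -/
def IsBounded {S T : Type*} (f : Multiset S → T) : Prop :=
  ∃ c : ℕ, IsBoundedBy c f

/-! ### Featured graphs -/

/-- A finite non-empty directed graph (loops are allowed) whose vertices carry feature vectors
in `{0,1}^d`. -/
structure FeaturedGraph (d : ℕ) where
  /-- the vertices -/
  V : Type
  [fintypeV : Fintype V]
  [nonemptyV : Nonempty V]
  /-- the edges -/
  graph : Digraph V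
  /-- the feature vectors, with `true` for `1` and `false` for `0` -/
  feat : V → Fin d → Bool

attribute [instance] FeaturedGraph.fintypeV FeaturedGraph.nonemptyV

namespace FeaturedGraph

variable {d : ℕ}

open Classical in
/-- The out-neighbourhood of a vertex. -/
noncomputable def outNbhd (G : FeaturedGraph d) (v : G.V) : Finset G.V :=
  Finset.univ.filter fun u => G.graph.Adj v u

/-- All feature vectors of `G` belong to the set `F` of admissible feature vectors. -/
def FeaturesIn (G : FeaturedGraph d) (F : Set (Fin d → Bool)) : Prop :=
  ∀ v : G.V, G.feat v ∈ F

end FeaturedGraph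

/-! ### ACR-GNNs -/

/-- Aggregate-combine-readout graph neural networks with input dimension `d`. Layer `i + 1` of
the usual counting from `1` has the index `i : Fin layers` here; it maps embeddings of dimension
`dim i.castSucc` to embeddings of dimension `dim i.succ`. -/
structure ACRGNN (d : ℕ) where
  /-- the number of layers -/
  layers : ℕ
  /-- the dimensions of the embeddings -/
  dim : Fin (layers + 1) → ℕ
  dim_zero : dim 0 = d
  /-- the combination functions; the arguments are the current embedding of the vertex, the
  aggregated embeddings of its out-neighbours, and the global readout -/
  comb : (i : Fin layers) → (Fin (dim i.castSucc) → ℝ) → (Fin (dim i.castSucc) → ℝ) →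
    (Fin (dim i.castSucc) → ℝ) → (Fin (dim i.succ) → ℝ)
  /-- the aggregation functions -/
  agg : (i : Fin layers) → Multiset (Fin (dim i.castSucc) → ℝ) → (Fin (dim i.castSucc) → ℝ)
  /-- the readout functions -/
  read : (i : Fin layers) → Multiset (Fin (dim i.castSucc) → ℝ) → (Fin (dim i.castSucc) → ℝ)
  /-- the binary classifier -/
  cls : (Fin (dim (Fin.last layers)) → ℝ) → Bool

namespace ACRGNN

variable {d : ℕ}

/-- The embedding `f^(i)` computed by the network on the graph `G`. -/
noncomputable def embed (N : ACRGNN d) (G : FeaturedGraph d) (i : Fin (N.layers + 1)) :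
    G.V → (Fin (N.dim i) → ℝ) :=
  Fin.induction (motive := fun i => G.V → (Fin (N.dim i) → ℝ))
    (fun v j => if G.feat v (Fin.cast N.dim_zero j) = true then 1 else 0)
    (fun i f v => N.comb i (f v)
      (N.agg i ((G.outNbhd v).val.map f))
      (N.read i ((Finset.univ : Finset G.V).val.map f)))
    i

/-- The network accepts the pointed featured graph `(G, v)`. -/
def Accepts (N : ACRGNN d) (G : FeaturedGraph d) (v : G.V) : Prop :=
  N.cls (N.embed G (Fin.last N.layers) v) = true

/-- All aggregation functions are bounded; nothing is required of the readout functions. -/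
def HasBoundedAggregation (N : ACRGNN d) : Prop :=
  ∀ i : Fin N.layers, IsBounded (N.agg i)

end ACRGNN

/-! ### Graded modal logic with graded global modalities -/

/-- Formulas of `d`-dimensional graded modal logic with graded global modalities. -/
inductive GMLE (d : ℕ) : Type
  | top : GMLE d
  | prop (i : Fin d) : GMLE d
  | neg (φ : GMLE d) : GMLE d
  | and (φ ψ : GMLE d) : GMLE d
  /-- at least `k` out-neighbours satisfy `φ` -/
  | diamond (k : ℕ) (φ : GMLE d) : GMLE d
  /-- at least `k` vertices satisfy `φ` -/
  | atLeast (k : ℕ) (φ : GMLE d) : GMLE d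

/-- Satisfaction of a formula at a vertex. -/
def GMLE.Sat {d : ℕ} (G : FeaturedGraph d) : GMLE d → G.V → Prop
  | .top, _ => True
  | .prop i, v => G.feat v i = true
  | .neg φ, v => ¬ GMLE.Sat G φ v
  | .and φ ψ, v => GMLE.Sat G φ v ∧ GMLE.Sat G ψ v
  | .diamond k φ, v => k ≤ {u : G.V | u ∈ G.outNbhd v ∧ GMLE.Sat G φ u}.ncard
  | .atLeast k φ, _ => k ≤ {u : G.V | GMLE.Sat G φ u}.ncard

/-! ### First-order logic -/

/-- The relation symbols for `d`-featured graphs: one binary symbol for the edges and `d` unary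
symbols for the features. -/
inductive GraphRel (d : ℕ) : ℕ → Type
  | edge : GraphRel d 2
  | feature (i : Fin d) : GraphRel d 1

/-- The first-order language of `d`-featured graphs (equality is a logical symbol). -/
def graphLanguage (d : ℕ) : FirstOrder.Language where
  Functions := fun _ => Empty
  Relations := GraphRel d

/-- A `d`-featured graph as a first-order structure. -/
instance FeaturedGraph.foStructure {d : ℕ} (G : FeaturedGraph d) :
    (graphLanguage d).Structure G.V where
  funMap := fun f _ => Empty.elim f
  RelMap := fun r x =>
    match r, x with
    | .edge, x => G.graph.Adj (x 0) (x 1)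
    | .feature i, x => G.feat (x 0) i = true

/-- First-order classifiers: first-order formulas with one free variable. -/
abbrev FOClassifier (d : ℕ) : Type := (graphLanguage d).Formula Unit

/-- The vertex `v` of `G` satisfies the first-order classifier `φ`. -/
def FOClassifier.Sat {d : ℕ} (φ : FOClassifier d) (G : FeaturedGraph d) (v : G.V) : Prop :=
  FirstOrder.Language.Formula.Realize φ (fun _ : Unit => v)

/-! ### Comparing classifiers -/

/-- The network `N` captures the classifier `φ` over the pointed graphs with feature vectors
in `F`. -/
def Captures {d : ℕ} (F : Set (Fin d → Bool)) (N : ACRGNN d) (φ : FOClassifier d) : Prop :=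
  ∀ G : FeaturedGraph d, G.FeaturesIn F → ∀ v : G.V, N.Accepts G v ↔ φ.Sat G v

/-- The classifiers `φ` and `ψ` are equivalent over the pointed graphs with feature vectors
in `F`. -/
def Equivalent {d : ℕ} (F : Set (Fin d → Bool)) (φ : FOClassifier d) (ψ : GMLE d) : Prop :=
  ∀ G : FeaturedGraph d, G.FeaturesIn F → ∀ v : G.V, φ.Sat G v ↔ ψ.Sat G v

end ACR

/-! From formulas to networks: combination, aggregation and readout are arbitrary functions, so a
single real number can store a whole set of formulas. A network that keeps at each vertex the set of
formulas taken to be true there evaluates one more level of modalities per layer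
(`decodeVec_evalEmbed`). Grades up to `c` only need multiplicities up to `c`, so the aggregation is
bounded.

From networks to formulas: if all aggregations are `c`-bounded, acceptance depends only on the local
type of the vertex (radius `L`, counts cut off at `c`) and on the exact number of vertices of each
local type (`ACRGNN.accepts_congr`). It remains to show that first-order definability makes the
exact numbers irrelevant beyond some threshold. Every graph may be replaced by a blow-up with the
same type counts, in which vertices of type `s` point to the first `D s t ≤ c` vertices of type `t`
(`FeaturedGraph.localType_blowup`). All other vertices of type `t` receive no edges and are
interchangeable, so a first-order formula cannot tell large counts apart
(`exists_realize_blowup_iff`). Hence a captured classifier depends only on the local type and on the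
counts cut off at some `K` (`Captures.sat_of_restrict_eq`). There are finitely many such data, each
definable in the logic, and a finite disjunction defines the classifier. -/

namespace ACR

/-! ### Cut-off multisets and bounded functions -/

section Multisets

variable {S T : Type*}

theorem restrict_eq_restrict_iff {c : ℕ} {M M' : Multiset S} :
    restrict c M = restrict c M' ↔
      ∀ x, min (@Multiset.count S (Classical.decEq S) x M) c
        = min (@Multiset.count S (Classical.decEq S) x M') c := by
  classical
  rw [Multiset.ext]
  refine forall_congr' fun x => ?_
  rw [← count_restrict, ← count_restrict]

theorem restrict_restrict_of_le {c c' : ℕ} (h : c ≤ c') (M : Multiset S) :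
    restrict c (restrict c' M) = restrict c M := by
  classical
  rw [restrict_eq_restrict_iff]
  intro x
  have := count_restrict c' M x
  have h2 : @Multiset.count S (Classical.decEq S) x (restrict c' M)
    = min (@Multiset.count S (Classical.decEq S) x M) c' := by convert this
  omega

/-- If some element satisfying `P` has multiplicity at least `c`, both minima are `c`. Otherwise the
relevant multiplicities are below the cut-off, so the filtered multisets coincide. -/
theorem min_countP_eq_of_restrict_eq {c : ℕ} {M M' : Multiset S}
    (h : restrict c M = restrict c M') (P : S → Prop) [DecidablePred P] :
    min (M.countP P) c = min (M'.countP P) c := by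
  classical
  have h' : ∀ x, min (M.count x) c = min (M'.count x) c := fun x => by
    rw [← count_restrict, ← count_restrict, h]
  by_cases hP : ∃ x, P x ∧ c ≤ M.count x
  · obtain ⟨x, hx, hc⟩ := hP
    have hle : ∀ N : Multiset S, N.count x ≤ N.countP P := fun N => by
      rw [Multiset.countP_eq_card_filter, ← Multiset.count_filter_of_pos hx]
      exact Multiset.count_le_card _ _
    have := hle M
    have := hle M'
    have := h' x
    omega
  · push Not at hP
    have : M.filter P = M'.filter P := by
      ext x
      rw [Multiset.count_filter, Multiset.count_filter]
      split_ifs with hx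
      · have := hP x hx
        have := h' x
        omega
      · rfl
    rw [Multiset.countP_eq_card_filter, Multiset.countP_eq_card_filter, this]

theorem restrict_map_congr {c : ℕ} {M M' : Multiset S} (h : restrict c M = restrict c M')
    (f : S → T) : restrict c (M.map f) = restrict c (M'.map f) := by
  classical
  rw [restrict_eq_restrict_iff]
  intro y
  have := min_countP_eq_of_restrict_eq h (fun x => y = f x)
  rw [Multiset.countP_eq_card_filter, Multiset.countP_eq_card_filter] at this
  convert this <;> exact Multiset.count_map ..

theorem IsBoundedBy.congr {c : ℕ} {f : Multiset S → T} (hf : IsBoundedBy c f)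
    {M M' : Multiset S} (h : restrict c M = restrict c M') : f M = f M' := by
  rw [hf M, hf M', h]

theorem IsBoundedBy.mono {c c' : ℕ} {f : Multiset S → T} (hf : IsBoundedBy c f) (h : c ≤ c') :
    IsBoundedBy c' f := fun M => hf.congr (restrict_restrict_of_le h M).symm

end Multisets

theorem ncard_setOf_mem_and {α β : Type*} (A : Finset α) (f : α → β) (Q : β → Prop)
    [DecidablePred Q] :
    {a | a ∈ A ∧ Q (f a)}.ncard = (A.val.map f).countP Q := by
  classical
  rw [Multiset.countP_map]
  have : {a | a ∈ A ∧ Q (f a)} = ↑(A.filter fun a => Q (f a)) := by ext; simp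
  rw [this, Set.ncard_coe_finset]
  rfl

namespace ACRGNN

variable {d : ℕ} (N : ACRGNN d) (G : FeaturedGraph d)

theorem embed_succ (i : Fin N.layers) (v : G.V) :
    N.embed G i.succ v = N.comb i (N.embed G i.castSucc v)
      (N.agg i ((G.outNbhd v).val.map (N.embed G i.castSucc)))
      (N.read i ((Finset.univ : Finset G.V).val.map (N.embed G i.castSucc))) := by
  unfold embed
  rw [Fin.induction_succ]

end ACRGNN

/-! ### Networks for formulas -/

namespace GMLE

variable {d : ℕ}

/-- The nesting depth of the modalities. -/
def depth : GMLE d → ℕ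
  | .top => 0
  | .prop _ => 0
  | .neg φ => φ.depth
  | .and φ ψ => max φ.depth ψ.depth
  | .diamond _ φ => φ.depth + 1
  | .atLeast _ φ => φ.depth + 1

/-- The largest grade of a modality. -/
def width : GMLE d → ℕ
  | .top => 0
  | .prop _ => 0
  | .neg φ => φ.width
  | .and φ ψ => max φ.width ψ.width
  | .diamond k φ => max k φ.width
  | .atLeast k φ => max k φ.width

/-- A code number of a formula. -/
def code : GMLE d → ℕ
  | .top => Nat.pair 0 0
  | .prop i => Nat.pair 1 i
  | .neg φ => Nat.pair 2 φ.code
  | .and φ ψ => Nat.pair 3 (Nat.pair φ.code ψ.code)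
  | .diamond k φ => Nat.pair 4 (Nat.pair k φ.code)
  | .atLeast k φ => Nat.pair 5 (Nat.pair k φ.code)

theorem code_injective : Function.Injective (code : GMLE d → ℕ) := by
  intro φ
  induction φ with
  | top => intro ψ h; cases ψ <;> simp [code, Nat.pair_eq_pair] at h ⊢
  | prop i => intro ψ h; cases ψ <;> simp [code, Nat.pair_eq_pair] at h ⊢; exact Fin.ext h
  | neg φ ih => intro ψ h; cases ψ <;> simp [code, Nat.pair_eq_pair] at h ⊢; exact ih h
  | and φ φ' ih ih' =>
    intro ψ h; cases ψ <;> simp [code, Nat.pair_eq_pair] at h ⊢; exact ⟨ih h.1, ih' h.2⟩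
  | diamond k φ ih =>
    intro ψ h; cases ψ <;> simp [code, Nat.pair_eq_pair] at h ⊢; exact ⟨h.1, ih h.2⟩
  | atLeast k φ ih =>
    intro ψ h; cases ψ <;> simp [code, Nat.pair_eq_pair] at h ⊢; exact ⟨h.1, ih h.2⟩

open Classical in
/-- A real number that codes a set of formulas. -/
noncomputable def encodeTheory (θ : GMLE d → Prop) : ℝ :=
  Cardinal.cantorFunction (1 / 3) fun n => decide (∃ χ, code χ = n ∧ θ χ)

/-- The ratio `1 / 3` is below `1 / 2`, so the Cantor function is injective and the digit at
position `code χ` recovers `θ χ`. -/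
theorem encodeTheory_injective :
    Function.Injective (encodeTheory : (GMLE d → Prop) → ℝ) := by
  intro θ θ' h
  have h' := Cardinal.cantorFunction_injective (by norm_num) (by norm_num) h
  funext χ
  have := congrFun h' (code χ)
  simpa [code_injective.eq_iff] using this

/-- The truth values of formulas, given those of the atoms, and those of the formulas that start
with a modality (both kinds of modalities are looked up under `diamond`). -/
def evalStep (θ a r : GMLE d → Prop) : GMLE d → Prop
  | .top => True
  | .prop i => θ (.prop i)
  | .neg φ => ¬ evalStep θ a r φ
  | .and φ ψ => evalStep θ a r φ ∧ evalStep θ a r ψ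
  | .diamond k φ => a (.diamond k φ)
  | .atLeast k φ => r (.diamond k φ)

open Classical in
/-- The graded modal statements that hold for a multiset of theories. -/
noncomputable def modalTheory (M : Multiset (GMLE d → Prop)) : GMLE d → Prop
  | .diamond k φ => k ≤ M.countP fun θ => θ φ
  | _ => False

/-- The dimensions of the embeddings in the network that evaluates formulas. -/
def evalDim (d L : ℕ) : Fin (L + 1) → ℕ := Fin.cons d fun _ => 1

/-- The theory that an embedding stands for. -/
noncomputable def decodeVec (L : ℕ) :
    (i : Fin (L + 1)) → (Fin (evalDim d L i) → ℝ) → GMLE d → Prop :=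
  Fin.cases (fun x χ => ∃ j : Fin d, χ = .prop j ∧ x j = 1)
    (fun _ x => Function.invFun encodeTheory (x (0 : Fin 1)))

/-- The embedding that stands for a theory. -/
noncomputable def encodeVec (L : ℕ) :
    (i : Fin (L + 1)) → (GMLE d → Prop) → (Fin (evalDim d L i) → ℝ) :=
  Fin.cases (fun _ _ => 0) (fun _ θ _ => encodeTheory θ)

theorem decodeVec_encodeVec {L : ℕ} {i : Fin (L + 1)} (hi : i ≠ 0) (θ : GMLE d → Prop) :
    decodeVec L i (encodeVec L i θ) = θ := by
  obtain ⟨j, rfl⟩ := Fin.exists_succ_eq.2 hi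
  exact Function.leftInverse_invFun encodeTheory_injective θ

/-- The aggregation function of the network that evaluates formulas. -/
noncomputable def evalAgg (c L : ℕ) (i : Fin (L + 1)) (M : Multiset (Fin (evalDim d L i) → ℝ)) :
    Fin (evalDim d L i) → ℝ :=
  encodeVec L i (modalTheory ((restrict c M).map (decodeVec L i)))

/-- A network that evaluates the formulas of small depth and width. -/
noncomputable def evalNetwork (d c L : ℕ) : ACRGNN d where
  layers := L
  dim := evalDim d L
  dim_zero := rfl
  comb := fun i x a r => encodeVec L i.succ
    (evalStep (decodeVec L _ x) (decodeVec L _ a) (decodeVec L _ r))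
  agg := fun i => evalAgg c L i.castSucc
  read := fun i => evalAgg c L i.castSucc
  cls := fun _ => false

/-- Cutting off at `c` does not affect the comparison with a grade `k ≤ c`. Layer `0` is excluded
because its dimension is `d`, possibly `0`, and `encodeVec` stores nothing there. -/
theorem modalTheory_evalAgg {c L : ℕ} {i : Fin (L + 1)} (hi : i ≠ 0) {V : Type*} (A : Finset V)
    (f : V → Fin (evalDim d L i) → ℝ) (k : ℕ) (hk : k ≤ c) (φ : GMLE d) :
    decodeVec L i (evalAgg c L i (A.val.map f)) (.diamond k φ) ↔
      k ≤ {u | u ∈ A ∧ decodeVec L i (f u) φ}.ncard := by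
  classical
  rw [evalAgg, decodeVec_encodeVec hi, modalTheory]
  have h1 := ncard_setOf_mem_and A (fun u => decodeVec L i (f u)) (fun θ => θ φ)
  have h2 := min_countP_eq_of_restrict_eq (restrict_map_congr
    (restrict_restrict_of_le le_rfl (A.val.map f)) (decodeVec L i) (c := c)) (fun θ => θ φ)
  rw [Multiset.map_map] at h2
  simp only [Function.comp_def] at h2
  rw [h1]
  have h3 : ∀ a b : ℕ, min a c = min b c → (k ≤ a ↔ k ≤ b) := fun a b h => by omega
  convert h3 _ _ h2

/-- The embeddings computed by `evalNetwork`. -/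
noncomputable def evalEmbed (c L : ℕ) (G : FeaturedGraph d) (i : Fin (L + 1)) :
    G.V → (Fin (evalDim d L i) → ℝ) :=
  (evalNetwork d c L).embed G i

theorem evalEmbed_succ (c L : ℕ) (G : FeaturedGraph d) (i : Fin L) (v : G.V) :
    evalEmbed c L G i.succ v = encodeVec L i.succ (evalStep
      (decodeVec L _ (evalEmbed c L G i.castSucc v))
      (decodeVec L _ (evalAgg c L _ ((G.outNbhd v).val.map (evalEmbed c L G i.castSucc))))
      (decodeVec L _ (evalAgg c L _
        ((Finset.univ : Finset G.V).val.map (evalEmbed c L G i.castSucc))))) :=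
  ACRGNN.embed_succ (evalNetwork d c L) G i v

/-- The inequality `χ.depth < i` is strict because the step out of layer `0` can only evaluate
Boolean combinations of atoms; each later layer adds one modality. -/
theorem decodeVec_evalEmbed (c L : ℕ) (G : FeaturedGraph d) (i : Fin (L + 1)) :
    ∀ v : G.V, (∀ j, decodeVec L i (evalEmbed c L G i v) (.prop j) ↔
        G.feat v j = true) ∧
      ∀ χ : GMLE d, χ.depth < i → χ.width ≤ c →
        (decodeVec L i (evalEmbed c L G i v) χ ↔ χ.Sat G v) := by
  induction i using Fin.induction with
  | zero =>
    intro v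
    refine ⟨fun j => ?_, fun χ h => absurd h (Nat.not_lt_zero _)⟩
    change (∃ j' : Fin d, GMLE.prop j = .prop j' ∧
      (if G.feat v j' = true then (1 : ℝ) else 0) = 1) ↔ _
    simp
  | succ i ih =>
    intro v
    rw [evalEmbed_succ, decodeVec_encodeVec (Fin.succ_ne_zero i)]
    refine ⟨(ih v).1, fun χ hd hw => ?_⟩
    induction χ with
    | top => simp [evalStep, Sat]
    | prop j => exact (ih v).1 j
    | neg φ hφ => exact not_congr (hφ hd hw)
    | and φ ψ hφ hψ =>
      simp only [depth, width] at hd hw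
      exact and_congr (hφ (by omega) (by omega)) (hψ (by omega) (by omega))
    | diamond k φ _ =>
      simp only [depth, width, Fin.val_succ] at hd hw
      -- A formula with a modality has positive depth, so the current layer is not the input layer.
      have hi : i.castSucc ≠ 0 := fun h => by
        have := congrArg Fin.val h
        simp at this
        omega
      rw [evalStep, modalTheory_evalAgg hi _ _ _ (by omega), Sat]
      simp only [fun u => (ih u).2 φ (by simp; omega) (by omega)]
    | atLeast k φ _ =>
      simp only [depth, width, Fin.val_succ] at hd hw
      have hi : i.castSucc ≠ 0 := fun h => by
        have := congrArg Fin.val h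
        simp at this
        omega
      rw [evalStep, modalTheory_evalAgg hi _ _ _ (by omega), Sat]
      simp only [fun u => (ih u).2 φ (by simp; omega) (by omega), Finset.mem_univ, true_and]

theorem isBoundedBy_evalAgg (c L : ℕ) (i : Fin (L + 1)) :
    IsBoundedBy c (evalAgg c L i : _ → Fin (evalDim d L i) → ℝ) := fun M => by
  unfold evalAgg
  rw [restrict_restrict_of_le le_rfl]

theorem evalNetwork_hasBoundedAggregation (d c L : ℕ) :
    (evalNetwork d c L).HasBoundedAggregation :=
  fun i => ⟨c, isBoundedBy_evalAgg c L i.castSucc⟩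

open Classical in
theorem exists_network (ψ : GMLE d) : ∃ N : ACRGNN d, N.HasBoundedAggregation ∧
    ∀ (G : FeaturedGraph d) (v : G.V), N.Accepts G v ↔ ψ.Sat G v := by
  refine ⟨{ evalNetwork d ψ.width (ψ.depth + 1) with
    cls := fun x => decide (decodeVec (ψ.depth + 1) (Fin.last _) x ψ) },
    evalNetwork_hasBoundedAggregation d ψ.width (ψ.depth + 1), fun G v => ?_⟩
  refine decide_eq_true_iff.trans ?_
  exact (decodeVec_evalEmbed ψ.width (ψ.depth + 1) G (Fin.last _) v).2 ψ (by simp) le_rfl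

end GMLE
/-! ### Local types -/

/-- Local types of radius `i`, in which numbers of neighbours are cut off at `c`. -/
def LocalType (d c : ℕ) : ℕ → Type
  | 0 => Fin d → Bool
  | i + 1 => LocalType d c i × (LocalType d c i → Fin (c + 1))

variable {d : ℕ}

instance LocalType.finite (c : ℕ) : ∀ i, Finite (LocalType d c i)
  | 0 => inferInstanceAs (Finite (Fin d → Bool))
  | i + 1 =>
    have := LocalType.finite c i
    inferInstanceAs (Finite (LocalType d c i × (LocalType d c i → Fin (c + 1))))

noncomputable instance LocalType.fintype (c i : ℕ) : Fintype (LocalType d c i) :=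
  Fintype.ofFinite _

/-- The restriction of a local type to a smaller radius. -/
def LocalType.pred {c i : ℕ} (t : LocalType d c (i + 1)) : LocalType d c i := t.1

/-- The feature vector of the vertices of a local type. -/
def LocalType.feat {c : ℕ} : ∀ {i : ℕ}, LocalType d c i → Fin d → Bool
  | 0, t => t
  | _ + 1, t => LocalType.feat t.1

namespace FeaturedGraph

variable (c : ℕ) (G H : FeaturedGraph d)

open Classical in
/-- The local type of a vertex. -/
noncomputable def localType : (i : ℕ) → G.V → LocalType d c i
  | 0 => G.feat
  | i + 1 => fun v => (localType i v, fun s =>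
      ⟨min (((G.outNbhd v).val.map (localType i)).count s) c, by omega⟩)

/-- The local types of the vertices. -/
noncomputable def typeCount (i : ℕ) : Multiset (LocalType d c i) :=
  (Finset.univ : Finset G.V).val.map (G.localType c i)

variable {c G H}

open Classical in
theorem localType_succ_eq_mk_iff {i : ℕ} {v : G.V} {t : LocalType d c (i + 1)} :
    G.localType c (i + 1) v = t ↔ G.localType c i v = t.1 ∧
      ∀ s, min (((G.outNbhd v).val.map (G.localType c i)).count s) c = (t.2 s : ℕ) :=
  Prod.ext_iff.trans (and_congr_right fun _ =>
    funext_iff.trans (forall_congr' fun _ => Fin.ext_iff))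

theorem localType_succ_eq_iff {i : ℕ} {v : G.V} {w : H.V} :
    G.localType c (i + 1) v = H.localType c (i + 1) w ↔
      G.localType c i v = H.localType c i w ∧
        restrict c ((G.outNbhd v).val.map (G.localType c i)) =
          restrict c ((H.outNbhd w).val.map (H.localType c i)) := by
  rw [restrict_eq_restrict_iff]
  exact localType_succ_eq_mk_iff

theorem feat_localType (i : ℕ) (v : G.V) : (G.localType c i v).feat = G.feat v := by
  induction i with
  | zero => rfl
  | succ i ih => exact ih

theorem localType_eq_of_le {i j : ℕ} (h : i ≤ j) {v : G.V} {w : H.V}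
    (hvw : G.localType c j v = H.localType c j w) : G.localType c i v = H.localType c i w := by
  induction j, h using Nat.le_induction with
  | base => exact hvw
  | succ j _ ih => exact ih (localType_succ_eq_iff.1 hvw).1

theorem typeCount_eq_of_le {i j : ℕ} (h : i ≤ j) (hGH : G.typeCount c j = H.typeCount c j) :
    G.typeCount c i = H.typeCount c i := by
  induction j, h using Nat.le_induction with
  | base => exact hGH
  | succ j _ ih =>
    refine ih ?_
    have := congrArg (Multiset.map LocalType.pred) hGH
    unfold typeCount at this
    rw [Multiset.map_map, Multiset.map_map] at this
    exact this

end FeaturedGraph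

/-- A network with bounded aggregation sees only the local type of a vertex and the numbers of
vertices of each local type. -/
theorem ACRGNN.accepts_congr {c : ℕ} {N : ACRGNN d} (hN : ∀ i, IsBoundedBy c (N.agg i))
    {G H : FeaturedGraph d} (hGH : G.typeCount c N.layers = H.typeCount c N.layers)
    {v : G.V} {w : H.V} (hvw : G.localType c N.layers v = H.localType c N.layers w) :
    N.Accepts G v ↔ N.Accepts H w := by
  have key : ∀ i : Fin (N.layers + 1), ∃ g : LocalType d c i → Fin (N.dim i) → ℝ,
      N.embed G i = g ∘ G.localType c i ∧ N.embed H i = g ∘ H.localType c i := by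
    intro i
    induction i using Fin.induction with
    | zero =>
      exact ⟨fun t j => if t (Fin.cast N.dim_zero j) = true then 1 else 0, rfl, rfl⟩
    | succ i ih =>
      obtain ⟨g, hgG, hgH⟩ := ih
      have hR : (Finset.univ : Finset G.V).val.map (N.embed G i.castSucc) =
          (Finset.univ : Finset H.V).val.map (N.embed H i.castSucc) := by
        rw [hgG, hgH, ← Multiset.map_map, ← Multiset.map_map]
        exact congrArg _ (FeaturedGraph.typeCount_eq_of_le i.castSucc.is_le hGH)
      have main : ∀ (A B : FeaturedGraph d) (a : A.V) (b : B.V),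
          N.embed A i.castSucc = g ∘ A.localType c i →
          N.embed B i.castSucc = g ∘ B.localType c i →
          (Finset.univ : Finset A.V).val.map (N.embed A i.castSucc) =
          (Finset.univ : Finset B.V).val.map (N.embed B i.castSucc) →
          A.localType c (i + 1) a = B.localType c (i + 1) b →
          N.embed A i.succ a = N.embed B i.succ b := by
        intro A B a b hA hB hR hab
        obtain ⟨h1, h2⟩ := FeaturedGraph.localType_succ_eq_iff.1 hab
        rw [N.embed_succ, N.embed_succ, hR]
        congr 1
        · rw [hA, hB]
          exact congrArg g h1
        · refine (hN i).congr ?_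
          rw [hA, hB, ← Multiset.map_map, ← Multiset.map_map]
          exact restrict_map_congr h2 g
      -- Treating both graphs as one disjoint union yields a single `g'` that serves `G` and `H`
      -- simultaneously.
      have hf : (Sum.elim (N.embed G i.succ) (N.embed H i.succ)).FactorsThrough
          (Sum.elim (G.localType c (i + 1)) (H.localType c (i + 1))) := by
        rintro (a | a) (b | b) hab
        · exact main G G a b hgG hgG rfl hab
        · exact main G H a b hgG hgH hR hab
        · exact main H G a b hgH hgG hR.symm hab
        · exact main H H a b hgH hgH rfl hab
      obtain ⟨g', hg'⟩ := (Function.factorsThrough_iff _).1 hf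
      exact ⟨g', funext fun a => congrFun hg' (.inl a), funext fun a => congrFun hg' (.inr a)⟩
  obtain ⟨g, hG, hH⟩ := key (Fin.last _)
  unfold Accepts
  rw [hG, hH]
  have : g (G.localType c N.layers v) = g (H.localType c N.layers w) := congrArg g hvw
  exact iff_of_eq (congrArg (fun x => N.cls x = true) this)

theorem ACRGNN.HasBoundedAggregation.exists_isBoundedBy {N : ACRGNN d}
    (hN : N.HasBoundedAggregation) : ∃ c, ∀ i, IsBoundedBy c (N.agg i) := by
  choose c hc using hN
  exact ⟨Finset.univ.sup c, fun i => (hc i).mono (Finset.le_sup (Finset.mem_univ i))⟩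

/-! ### Definability of local types and of their numbers -/

/-- A property of pointed graphs that some formula defines. -/
def GMLEDefinable (P : ∀ G : FeaturedGraph d, G.V → Prop) : Prop :=
  ∃ ψ : GMLE d, ∀ (G : FeaturedGraph d) (v : G.V), ψ.Sat G v ↔ P G v

namespace GMLEDefinable

variable {P Q : ∀ G : FeaturedGraph d, G.V → Prop}

theorem congr (hP : GMLEDefinable P) (h : ∀ G v, P G v ↔ Q G v) : GMLEDefinable Q :=
  hP.imp fun _ hψ G v => (hψ G v).trans (h G v)

theorem top : GMLEDefinable (fun (G : FeaturedGraph d) (_ : G.V) => True) :=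
  ⟨.top, fun _ _ => Iff.rfl⟩

theorem feat (j : Fin d) : GMLEDefinable (fun (G : FeaturedGraph d) v => G.feat v j = true) :=
  ⟨.prop j, fun _ _ => Iff.rfl⟩

theorem not (hP : GMLEDefinable P) : GMLEDefinable (fun G v => ¬ P G v) :=
  let ⟨ψ, hψ⟩ := hP
  ⟨.neg ψ, fun G v => not_congr (hψ G v)⟩

theorem and (hP : GMLEDefinable P) (hQ : GMLEDefinable Q) :
    GMLEDefinable (fun G v => P G v ∧ Q G v) :=
  let ⟨ψ, hψ⟩ := hP
  let ⟨χ, hχ⟩ := hQ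
  ⟨.and ψ χ, fun G v => and_congr (hψ G v) (hχ G v)⟩

theorem const (p : Prop) : GMLEDefinable (fun (G : FeaturedGraph d) (_ : G.V) => p) := by
  by_cases hp : p
  · exact top.congr fun _ _ => by simp [hp]
  · exact top.not.congr fun _ _ => by simp [hp]

theorem imp (hP : GMLEDefinable P) (hQ : GMLEDefinable Q) :
    GMLEDefinable (fun G v => P G v → Q G v) :=
  (hP.and hQ.not).not.congr fun _ _ => by tauto

theorem forall_finite {ι : Type*} [Finite ι] {P : ι → ∀ G : FeaturedGraph d, G.V → Prop}
    (hP : ∀ i, GMLEDefinable (P i)) : GMLEDefinable (fun G v => ∀ i, P i G v) := by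
  classical
  cases nonempty_fintype ι
  suffices ∀ s : Finset ι, GMLEDefinable (fun G v => ∀ i ∈ s, P i G v) from
    (this Finset.univ).congr fun _ _ => by simp
  intro s
  induction s using Finset.induction_on with
  | empty => exact top.congr fun _ _ => by simp
  | insert a s _ ih => exact ((hP a).and ih).congr fun _ _ => by simp

theorem exists_finite {ι : Type*} [Finite ι] {P : ι → ∀ G : FeaturedGraph d, G.V → Prop}
    (hP : ∀ i, GMLEDefinable (P i)) : GMLEDefinable (fun G v => ∃ i, P i G v) :=
  (forall_finite fun i => (hP i).not).not.congr fun _ _ => by simp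

theorem le_count_outNbhd {T : Type*} [DecidableEq T] {f : ∀ G : FeaturedGraph d, G.V → T} {t : T}
    (h : GMLEDefinable fun G v => f G v = t) (k : ℕ) :
    GMLEDefinable (fun G v => k ≤ ((G.outNbhd v).val.map (f G)).count t) := by
  obtain ⟨ψ, hψ⟩ := h
  refine ⟨.diamond k ψ, fun G v => ?_⟩
  have := ncard_setOf_mem_and (G.outNbhd v) (f G) fun x => t = x
  rw [GMLE.Sat, Multiset.count]
  beta_reduce
  rw [← this]
  simp only [hψ, eq_comm]

theorem le_count_univ {T : Type*} [DecidableEq T] {f : ∀ G : FeaturedGraph d, G.V → T} {t : T}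
    (h : GMLEDefinable fun G v => f G v = t) (k : ℕ) : GMLEDefinable
      (fun G _ => k ≤ ((Finset.univ : Finset G.V).val.map (f G)).count t) := by
  obtain ⟨ψ, hψ⟩ := h
  refine ⟨.atLeast k ψ, fun G v => ?_⟩
  have := ncard_setOf_mem_and (Finset.univ : Finset G.V) (f G) fun x => t = x
  rw [GMLE.Sat, Multiset.count]
  beta_reduce
  rw [← this]
  simp only [hψ, eq_comm, Finset.mem_univ, true_and]

theorem min_eq {f : ∀ G : FeaturedGraph d, G.V → ℕ}
    (h : ∀ k, GMLEDefinable fun G v => k ≤ f G v) (c n : ℕ) :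
    GMLEDefinable (fun G v => min (f G v) c = n) :=
  ((const (n ≤ c)).and ((h n).and ((const (n < c)).imp (h (n + 1)).not))).congr
    fun _ _ => by omega

theorem localType_eq (c : ℕ) : ∀ (i : ℕ) (t : LocalType d c i),
    GMLEDefinable (fun G v => G.localType c i v = t)
  | 0, t => by
    refine (forall_finite (P := fun j G v => G.feat v j = t j) fun j => ?_).congr
      fun G v => funext_iff.symm
    cases h : t j
    · exact (feat j).not.congr fun _ _ => by simp
    · exact feat j
  | i + 1, t => by
    classical
    refine ((localType_eq c i t.1).and (forall_finite (P := fun s G v =>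
      min (((G.outNbhd v).val.map (G.localType c i)).count s) c = (t.2 s : ℕ)) fun s =>
        min_eq (fun k => (localType_eq c i s).le_count_outNbhd k) c _)).congr fun _ _ =>
        FeaturedGraph.localType_succ_eq_mk_iff.symm

/-- A property is definable if it depends only on the local type of the vertex and on the
numbers of vertices of each local type, cut off at some number. -/
theorem exists_equiv_of_invariant (c L K : ℕ) (C : FeaturedGraph d → Prop)
    (P : ∀ G : FeaturedGraph d, G.V → Prop)
    (hP : ∀ (G H : FeaturedGraph d) (v : G.V) (w : H.V), C G → C H →
      G.localType c L v = H.localType c L w →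
      restrict K (G.typeCount c L) = restrict K (H.typeCount c L) → P G v → P H w) :
    ∃ ψ : GMLE d, ∀ (G : FeaturedGraph d) (v : G.V), C G → (P G v ↔ ψ.Sat G v) := by
  classical
  -- A disjunction over the finitely many data `θ`. Whether `θ` is realised by some `H` in `C` with
  -- `P` does not depend on `G`, so that conjunct is a constant.
  have hdef : GMLEDefinable (fun G v => ∃ θ : LocalType d c L × (LocalType d c L → Fin (K + 1)),
      (G.localType c L v = θ.1 ∧ ∀ t, min ((G.typeCount c L).count t) K = (θ.2 t : ℕ)) ∧
      ∃ (H : FeaturedGraph d) (w : H.V), C H ∧ P H w ∧ H.localType c L w = θ.1 ∧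
        ∀ t, min ((H.typeCount c L).count t) K = (θ.2 t : ℕ)) :=
    exists_finite fun θ => ((localType_eq c L θ.1).and (forall_finite fun t =>
      min_eq (fun k => (localType_eq c L t).le_count_univ k) K _)).and (const _)
  obtain ⟨ψ, hψ⟩ := hdef
  refine ⟨ψ, fun G v hG => ?_⟩
  rw [hψ]
  constructor
  · intro h
    exact ⟨(G.localType c L v, fun t => ⟨min ((G.typeCount c L).count t) K, by omega⟩),
      ⟨rfl, fun _ => rfl⟩, G, v, hG, h, rfl, fun _ => rfl⟩
  · rintro ⟨θ, ⟨h1, h2⟩, H, w, hH, hPH, h3, h4⟩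
    refine hP H G w v hH hG (h3.trans h1.symm) (restrict_eq_restrict_iff.2 fun t => ?_) hPH
    have := (h4 t).trans (h2 t).symm
    convert this

end GMLEDefinable
/-! ### Blow-ups -/

theorem ncard_fin_lt {n k : ℕ} (h : k ≤ n) : {j : Fin n | (j : ℕ) < k}.ncard = k := by
  have : {j : Fin n | (j : ℕ) < k} = Fin.castLE h '' Set.univ := by
    ext j
    exact ⟨fun hj => ⟨⟨j, hj⟩, trivial, rfl⟩, by rintro ⟨i, _, rfl⟩; exact i.2⟩
  rw [this, Set.ncard_image_of_injective _ (Fin.castLE_injective h), Set.ncard_univ, Nat.card_fin]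

section Blowup

variable {T : Type}

section

variable {m : T → ℕ}

open Classical in
/-- The permutation that exchanges two elements of the same summand. -/
noncomputable def sigmaSwap (t : T) (i j : Fin (m t)) : Equiv.Perm (Σ t, Fin (m t)) :=
  Equiv.swap ⟨t, i⟩ ⟨t, j⟩

open Classical in
theorem sigmaSwap_apply_left (t : T) (i j : Fin (m t)) : sigmaSwap t i j ⟨t, i⟩ = ⟨t, j⟩ :=
  Equiv.swap_apply_left _ _

open Classical in
theorem sigmaSwap_apply_right (t : T) (i j : Fin (m t)) : sigmaSwap t i j ⟨t, j⟩ = ⟨t, i⟩ :=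
  Equiv.swap_apply_right _ _

open Classical in
theorem sigmaSwap_apply_of_ne (t : T) (i j : Fin (m t)) {x : Σ t, Fin (m t)}
    (h1 : x ≠ ⟨t, i⟩) (h2 : x ≠ ⟨t, j⟩) : sigmaSwap t i j x = x :=
  Equiv.swap_apply_of_ne_of_ne h1 h2

theorem sigmaSwap_fst (t : T) (i j : Fin (m t)) (x : Σ t, Fin (m t)) :
    (sigmaSwap t i j x).1 = x.1 := by
  by_cases h1 : x = ⟨t, i⟩
  · rw [h1, sigmaSwap_apply_left]
  by_cases h2 : x = ⟨t, j⟩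
  · rw [h2, sigmaSwap_apply_right]
  rw [sigmaSwap_apply_of_ne t i j h1 h2]

/-- With `b` the row of `D` at the source of an edge, this says that swapping two vertices beyond
the bound preserves the edges. -/
theorem sigmaSwap_snd_lt_iff (t : T) (i j : Fin (m t)) (b : T → ℕ) (hi : b t ≤ i)
    (hj : b t ≤ j) (x : Σ t, Fin (m t)) :
    ((sigmaSwap t i j x).2 : ℕ) < b (sigmaSwap t i j x).1 ↔ (x.2 : ℕ) < b x.1 := by
  by_cases h1 : x = ⟨t, i⟩
  · rw [h1, sigmaSwap_apply_left]
    exact iff_of_false hj.not_gt hi.not_gt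
  by_cases h2 : x = ⟨t, j⟩
  · rw [h2, sigmaSwap_apply_right]
    exact iff_of_false hi.not_gt hj.not_gt
  rw [sigmaSwap_apply_of_ne t i j h1 h2]

end

variable [Fintype T]

/-- The graph with `m t` vertices `(t, 0), (t, 1), …` of each kind `t`, in which all vertices of
the kind `s` have edges to the first `D s t` vertices of the kind `t`. -/
def blowup (a : T → Fin d → Bool) (D : T → T → ℕ) (m : T → ℕ) (h : ∃ t, 0 < m t) :
    FeaturedGraph d where
  V := Σ t, Fin (m t)
  nonemptyV := h.elim fun t ht => ⟨⟨t, 0, ht⟩⟩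
  graph := ⟨fun x y => (y.2 : ℕ) < D x.1 y.1⟩
  feat := fun x => a x.1

variable {a : T → Fin d → Bool} {D : T → T → ℕ} {m m' : T → ℕ} {h : ∃ t, 0 < m t}
  {h' : ∃ t, 0 < m' t}

/-- The kind of a vertex. -/
def blowupKind (x : (blowup a D m h).V) : T := x.1

/-- The `j`th vertex of the kind `t`. -/
def blowupVertex (t : T) (j : Fin (m t)) : (blowup a D m h).V := ⟨t, j⟩

theorem blowupVertex_injective (t : T) :
    Function.Injective (blowupVertex (a := a) (D := D) (m := m) (h := h) t) :=
  sigma_mk_injective (β := fun t => Fin (m t))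

theorem ncard_blowupKind (t : T) (P : Fin (m t) → Prop) (Q : (blowup a D m h).V → Prop)
    (hPQ : ∀ j, P j ↔ Q (blowupVertex t j)) :
    {x : (blowup a D m h).V | Q x ∧ t = blowupKind x}.ncard = {j | P j}.ncard := by
  rw [← Set.ncard_image_of_injective _ (blowupVertex_injective (a := a) (D := D) (h := h) t)]
  congr 1
  ext ⟨s, j⟩
  constructor
  · rintro ⟨h1, h2⟩
    obtain rfl : t = s := h2
    exact ⟨j, (hPQ j).2 h1, rfl⟩
  · rintro ⟨j', h1, h2⟩
    rw [← h2]
    exact ⟨(hPQ j').1 h1, rfl⟩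

/-! ### Symmetries of blow-ups and first-order formulas -/

open FirstOrder Language

/-- The inclusion of a blow-up into a larger one. -/
def blowupEmbedding (hle : m ≤ m') :
    (blowup a D m h).V ↪[graphLanguage d] (blowup a D m' h').V where
  toFun x := ⟨x.1, Fin.castLE (hle x.1) x.2⟩
  inj' := by
    rintro ⟨t, i⟩ ⟨s, j⟩ hxy
    obtain rfl : t = s := congrArg Sigma.fst hxy
    have e : Fin.castLE (hle t) i = Fin.castLE (hle t) j := eq_of_heq (Sigma.mk.inj hxy).2
    rw [Fin.castLE_injective (hle t) e]
  map_fun' f := Empty.elim f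
  map_rel' r x := by
    cases r with
    | edge => exact Iff.rfl
    | feature i => exact Iff.rfl

/-- Two vertices of the same kind that receive no edges can be exchanged. -/
noncomputable def blowupSwap (t : T) (i j : Fin (m t)) (hi : ∀ s, D s t ≤ i)
    (hj : ∀ s, D s t ≤ j) : (blowup a D m h).V ≃[graphLanguage d] (blowup a D m h).V where
  toEquiv := sigmaSwap t i j
  map_fun' f := Empty.elim f
  map_rel' r x := by
    cases r with
    | edge =>
      refine Iff.trans ?_ (sigmaSwap_snd_lt_iff t i j (D (x 0).1) (hi _) (hj _) (x 1))
      exact iff_of_eq (congrArg (fun s => ((sigmaSwap t i j (x 1)).2 : ℕ) <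
        D s (sigmaSwap t i j (x 1)).1) (sigmaSwap_fst t i j (x 0)))
    | feature k =>
      exact iff_of_eq (congrArg (fun s => a s k = true) (sigmaSwap_fst t i j (x 0)))

theorem blowupSwap_apply_left (t : T) (i j : Fin (m t)) (hi : ∀ s, D s t ≤ i)
    (hj : ∀ s, D s t ≤ j) : blowupSwap (a := a) (h := h) t i j hi hj (blowupVertex t i) =
      blowupVertex t j :=
  sigmaSwap_apply_left t i j

theorem blowupSwap_apply_of_ne (t : T) (i j : Fin (m t)) (hi : ∀ s, D s t ≤ i)
    (hj : ∀ s, D s t ≤ j) {x : (blowup a D m h).V} (h1 : x ≠ blowupVertex t i)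
    (h2 : x ≠ blowupVertex t j) :
    blowupSwap (a := a) (h := h) t i j hi hj x = x :=
  sigmaSwap_apply_of_ne t i j h1 h2

/-- A Tarski–Vaught argument: a witness outside the smaller blow-up can be moved into it by an
automorphism of the larger one that fixes the parameters. The threshold `q` depends on `c` and the
formula, but not on the blow-ups. -/
theorem exists_realize_blowup_iff (c : ℕ) {n : ℕ}
    (ψ : (graphLanguage d).BoundedFormula Unit n) : ∃ q : ℕ,
      ∀ {T : Type} [Fintype T] (a : T → Fin d → Bool) (D : T → T → ℕ) (_ : ∀ s t, D s t ≤ c)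
        (m m' : T → ℕ) (h : ∃ t, 0 < m t) (h' : ∃ t, 0 < m' t) (hle : m ≤ m')
        (_ : ∀ t, m t = m' t ∨ q ≤ m t) (v : Unit → (blowup a D m h).V)
        (xs : Fin n → (blowup a D m h).V),
        ψ.Realize (blowupEmbedding (h' := h') hle ∘ v) (blowupEmbedding (h' := h') hle ∘ xs) ↔
          ψ.Realize v xs := by
  induction ψ with
  | falsum => exact ⟨0, fun _ _ _ _ _ _ _ _ _ _ _ => Iff.rfl⟩
  | equal t₁ t₂ =>
    refine ⟨0, fun _ _ _ _ _ _ _ _ _ _ _ => ?_⟩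
    simp only [BoundedFormula.Realize, ← Sum.comp_elim, HomClass.realize_term,
      EmbeddingLike.apply_eq_iff_eq]
  | rel R ts =>
    refine ⟨0, fun _ _ _ _ _ _ _ hle _ _ _ => ?_⟩
    simp only [BoundedFormula.Realize, ← Sum.comp_elim, HomClass.realize_term]
    exact (blowupEmbedding hle).map_rel R _
  | imp ψ χ ih₁ ih₂ =>
    obtain ⟨q₁, h₁⟩ := ih₁
    obtain ⟨q₂, h₂⟩ := ih₂
    refine ⟨max q₁ q₂, fun a D hD m m' h h' hle hq v xs => ?_⟩
    simp only [BoundedFormula.Realize]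
    rw [h₁ a D hD m m' h h' hle (fun t => (hq t).imp_right fun _ => by omega),
      h₂ a D hD m m' h h' hle (fun t => (hq t).imp_right fun _ => by omega)]
  | @all n ψ ih =>
    obtain ⟨q, hψ⟩ := ih
    -- The `n + 1` parameters use at most `n + 1` indices, so one of the at least `n + 2` indices in
    -- `[c, m t)` is free.
    refine ⟨max q (c + n + 2), fun a D hD m m' h h' hle hq v xs => ?_⟩
    have ih := hψ a D hD m m' h h' hle (fun t => (hq t).imp_right fun _ => by omega) v
    set ι := blowupEmbedding (a := a) (D := D) (h := h) (h' := h') hle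
    simp only [BoundedFormula.realize_all]
    refine ⟨fun H x => ?_, fun H y => ?_⟩
    · rw [← ih, Fin.comp_snoc]
      exact H _
    · obtain ⟨t, j, rfl⟩ : ∃ t j, blowupVertex t j = y := ⟨y.1, y.2, rfl⟩
      by_cases hj : (j : ℕ) < m t
      · have := (ih (Fin.snoc xs (blowupVertex t ⟨j, hj⟩))).2 (H _)
        rw [Fin.comp_snoc] at this
        exact this
      · obtain ⟨k, hk, hk'⟩ : ∃ k ∈ Finset.Ico c (m t), k ∉ (Finset.univ : Finset (Unit ⊕ Fin n)).image
            fun z => ((Sum.elim v xs z).2 : ℕ) := by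
          refine Finset.exists_mem_notMem_of_card_lt_card (Finset.card_image_le.trans_lt ?_)
          have := j.2
          have := hq t
          simp
          omega
        rw [Finset.mem_Ico] at hk
        have hkm : k < m' t := hk.2.trans_le (hle t)
        -- Both indices are at least `c`, so neither vertex receives edges. The parameters are
        -- fixed: they lie in the smaller blow-up, which misses `j`, and they avoid the index `k`.
        set σ := blowupSwap (a := a) (D := D) (h := h') t j ⟨k, hkm⟩
          (fun s => (hD s t).trans (by omega)) (fun s => (hD s t).trans hk.1)
        have hσ : ∀ z, σ (ι (Sum.elim v xs z)) = ι (Sum.elim v xs z) := by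
          intro z
          have hz : ((Sum.elim v xs z).2 : ℕ) ≠ k := fun hz =>
            hk' (Finset.mem_image.2 ⟨z, Finset.mem_univ _, hz⟩)
          generalize Sum.elim v xs z = w at hz
          obtain ⟨s, i⟩ := w
          refine blowupSwap_apply_of_ne _ _ _ _ _ (fun e => ?_) (fun e => ?_)
          · obtain rfl : s = t := congrArg Sigma.fst e
            have e' : Fin.castLE (hle s) i = j := eq_of_heq (Sigma.mk.inj e).2
            rw [← e'] at hj
            exact hj i.2
          · obtain rfl : s = t := congrArg Sigma.fst e
            have e' : Fin.castLE (hle s) i = ⟨k, hkm⟩ := eq_of_heq (Sigma.mk.inj e).2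
            exact hz (congrArg Fin.val e')
        have hv : σ ∘ ι ∘ v = ι ∘ v := funext fun z => hσ (.inl z)
        have hxs : σ ∘ ι ∘ xs = ι ∘ xs := funext fun z => hσ (.inr z)
        rw [← StrongHomClass.realize_boundedFormula σ, Fin.comp_snoc, hv, hxs,
          blowupSwap_apply_left]
        have := (ih (Fin.snoc xs (blowupVertex t ⟨k, hk.2⟩))).2 (H _)
        rw [Fin.comp_snoc] at this
        exact this

end Blowup

/-! ### Local types in blow-ups -/

namespace FeaturedGraph

variable (c L : ℕ) (G : FeaturedGraph d)

open Classical in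
/-- The numbers of out-neighbours of the vertices of each local type, where a representative is
chosen for each local type, and the numbers are cut off at `c`. -/
noncomputable def outDegree (s t : LocalType d c L) : ℕ :=
  if h : ∃ v, G.localType c L v = s then
    min (((G.outNbhd h.choose).val.map (G.localType c L)).count t) c else 0

theorem outDegree_le (s t : LocalType d c L) : G.outDegree c L s t ≤ c := by
  unfold outDegree
  split_ifs
  · exact min_le_right _ _
  · exact Nat.zero_le _

open Classical in
theorem outDegree_le_count (s t : LocalType d c L) :
    G.outDegree c L s t ≤ min ((G.typeCount c L).count t) c := by
  unfold outDegree
  split_ifs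
  · refine min_le_min_right _ (Multiset.count_le_of_le _ (Multiset.map_le_map ?_))
    exact Finset.val_le_iff.2 (Finset.subset_univ _)
  · exact Nat.zero_le _

variable {c L G}

theorem exists_rep (m : LocalType d c L → ℕ) (hm : ∀ t, 0 < m t → t ∈ G.typeCount c L) :
    ∃ r : LocalType d c L → G.V, ∀ t, 0 < m t → G.localType c L (r t) = t ∧
      ∀ s, G.outDegree c L t s = min (@Multiset.count _ (Classical.decEq _) s
        ((G.outNbhd (r t)).val.map (G.localType c L))) c := by
  classical
  refine ⟨fun t => if h : ∃ v, G.localType c L v = t then h.choose else Classical.arbitrary _,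
    fun t ht => ?_⟩
  have hex : ∃ v, G.localType c L v = t := by
    obtain ⟨v, _, hv⟩ := Multiset.mem_map.1 (hm t ht)
    exact ⟨v, hv⟩
  simp only [dif_pos hex]
  refine ⟨hex.choose_spec, fun s => ?_⟩
  rw [outDegree, dif_pos hex]

section

variable {m : LocalType d c L → ℕ} {h : ∃ t, 0 < m t}

/-- A vertex of kind `t` sees, up to the cut-off `c`, the same kinds of out-neighbours as the
representative of `t` in `G`. By induction on the radius, the two have the same local type. The
bound `hD` ensures that there are enough vertices to point to. -/
theorem localType_blowup (hm : ∀ t, 0 < m t ↔ t ∈ G.typeCount c L)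
    (hD : ∀ s t, G.outDegree c L s t ≤ m t)
    (x : (blowup LocalType.feat (G.outDegree c L) m h).V) :
    (blowup LocalType.feat (G.outDegree c L) m h).localType c L x = x.1 := by
  classical
  obtain ⟨r, hr⟩ := exists_rep m fun t => (hm t).1
  let X := blowup LocalType.feat (G.outDegree c L) m h
  have hpos : ∀ x : X.V, 0 < m x.1 := fun x => x.2.pos
  have hout : ∀ x : X.V, restrict c ((X.outNbhd x).val.map blowupKind) =
      restrict c ((G.outNbhd (r x.1)).val.map (G.localType c L)) := by
    intro x
    rw [restrict_eq_restrict_iff]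
    intro t
    have e : ∀ i : DecidableEq (LocalType d c L),
        @Multiset.count _ i t ((X.outNbhd x).val.map blowupKind) = G.outDegree c L x.1 t := by
      intro i
      rw [Multiset.count, ← ncard_setOf_mem_and (X.outNbhd x) blowupKind (fun s => t = s)]
      rw [ncard_blowupKind t (fun j => (j : ℕ) < G.outDegree c L x.1 t)
        (fun y => y ∈ X.outNbhd x)
        fun j => by
          rw [outNbhd, Finset.mem_filter]
          exact (and_iff_right (Finset.mem_univ _)).symm, ncard_fin_lt (hD _ _)]
    rw [e, (hr _ (hpos x)).2]
    omega
  have key : ∀ i ≤ L, ∀ x : X.V, X.localType c i x = G.localType c i (r x.1) := by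
    intro i
    induction i with
    | zero =>
      intro _ x
      change LocalType.feat x.1 = G.feat (r x.1)
      rw [← feat_localType (c := c) L, (hr _ (hpos x)).1]
    | succ i ih =>
      intro hi x
      have ih' := ih (by omega)
      refine localType_succ_eq_iff.2 ⟨ih' x, ?_⟩
      have h1 : X.localType c i = (fun t => G.localType c i (r t)) ∘ blowupKind :=
        funext fun y => ih' y
      -- A vertex `u` and the representative of its radius-`L` type agree up to radius `L`, hence up
      -- to radius `i`.
      have h2 : (G.outNbhd (r x.1)).val.map (G.localType c i) =
          (G.outNbhd (r x.1)).val.map ((fun t => G.localType c i (r t)) ∘ G.localType c L) := by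
        refine Multiset.map_congr rfl fun u _ => ?_
        have hpu : 0 < m (G.localType c L u) := (hm _).2 (Multiset.mem_map_of_mem _ (Finset.mem_univ u))
        exact localType_eq_of_le (by omega) (hr _ hpu).1.symm
      rw [h1, h2, ← Multiset.map_map, ← Multiset.map_map]
      exact restrict_map_congr (hout x) _
  exact (key L le_rfl x).trans (hr _ (hpos x)).1

open Classical in
theorem count_typeCount_blowup (hm : ∀ t, 0 < m t ↔ t ∈ G.typeCount c L)
    (hD : ∀ s t, G.outDegree c L s t ≤ m t) (t : LocalType d c L) :
    ((blowup LocalType.feat (G.outDegree c L) m h).typeCount c L).count t = m t := by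
  let X := blowup LocalType.feat (G.outDegree c L) m h
  have h1 : X.localType c L = blowupKind := funext fun x => localType_blowup hm hD x
  change ((Finset.univ : Finset X.V).val.map (X.localType c L)).countP (fun s => t = s) = m t
  rw [h1, ← ncard_setOf_mem_and (Finset.univ : Finset X.V) blowupKind (fun s => t = s),
    ncard_blowupKind t (fun _ => True) _ fun j => by simp, Set.ofPred_true, Set.ncard_univ,
    Nat.card_fin]

end

end FeaturedGraph
-- Invariance of captured first-order classifiers
theorem FeaturedGraph.count_typeCount_pos {c L : ℕ} (A : FeaturedGraph d) (v : A.V)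
    [DecidableEq (LocalType d c L)] :
    0 < (A.typeCount c L).count (A.localType c L v) :=
  Multiset.count_pos.2 (Multiset.mem_map_of_mem _ (Finset.mem_univ v))

/-- A first-order classifier that is captured by a network with bounded aggregation does not
distinguish a graph from a blow-up with the same numbers of vertices of each local type. -/
theorem Captures.sat_iff_sat_blowup {F : Set (Fin d → Bool)} {N : ACRGNN d} {φ : FOClassifier d}
    (hφ : Captures F N φ) {c : ℕ} (hN : ∀ i, IsBoundedBy c (N.agg i)) {G A : FeaturedGraph d}
    (hG : G.FeaturesIn F) (hA : A.FeaturesIn F) {m : LocalType d c N.layers → ℕ}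
    (hm : ∀ t, 0 < m t ↔ t ∈ G.typeCount c N.layers)
    (hD : ∀ s t, G.outDegree c N.layers s t ≤ m t)
    (hmA : ∀ t, m t = @Multiset.count _ (Classical.decEq _) t (A.typeCount c N.layers))
    (v : A.V) (hv : 0 < m (A.localType c N.layers v)) :
    φ.Sat A v ↔ φ.Sat (blowup LocalType.feat (G.outDegree c N.layers) m ⟨_, hv⟩)
      (blowupVertex (A.localType c N.layers v) ⟨0, hv⟩) := by
  classical
  have hX : (blowup LocalType.feat (G.outDegree c N.layers) m ⟨_, hv⟩).FeaturesIn F := by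
    intro x
    -- Every kind that occurs in the blow-up is realised in `G`, so its feature vector is
    -- admissible.
    obtain ⟨w, _, hw⟩ := Multiset.mem_map.1 ((hm (blowupKind x)).1 x.2.pos)
    have := FeaturedGraph.feat_localType (c := c) N.layers w
    rw [hw] at this
    exact (congrArg (· ∈ F) this).mpr (hG w)
  rw [← hφ A hA, ← hφ _ hX]
  refine ACRGNN.accepts_congr hN ?_ (FeaturedGraph.localType_blowup hm hD
    (blowupVertex (A.localType c N.layers v) ⟨0, hv⟩)).symm
  ext t
  rw [FeaturedGraph.count_typeCount_blowup hm hD, hmA]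

/-- A first-order classifier that is captured by a network with bounded aggregation depends only
on the local type of the vertex and on the numbers of vertices of each local type, cut off at some
number. -/
theorem Captures.sat_of_restrict_eq {F : Set (Fin d → Bool)} {N : ACRGNN d} {φ : FOClassifier d}
    (hφ : Captures F N φ) {c : ℕ} (hN : ∀ i, IsBoundedBy c (N.agg i)) : ∃ K,
    ∀ (G H : FeaturedGraph d) (v : G.V) (w : H.V), G.FeaturesIn F → H.FeaturesIn F →
      G.localType c N.layers v = H.localType c N.layers w →
      restrict K (G.typeCount c N.layers) = restrict K (H.typeCount c N.layers) →
      φ.Sat G v → φ.Sat H w := by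
  classical
  obtain ⟨q, hq⟩ := exists_realize_blowup_iff c φ
  -- The `1` makes `G` and `H` realise the same types, `c` lets the counts of `H` accommodate the
  -- out-degrees of `G`, and `q` is the first-order threshold.
  refine ⟨max (max c q) 1, fun G H v w hG hH hvw hGH hv => ?_⟩
  rw [restrict_eq_restrict_iff] at hGH
  set L := N.layers
  let mG : LocalType d c L → ℕ := fun t => @Multiset.count _ (Classical.decEq _) t (G.typeCount c L)
  let mH : LocalType d c L → ℕ := fun t => @Multiset.count _ (Classical.decEq _) t (H.typeCount c L)
  have hGH : ∀ t, min (mG t) (max (max c q) 1) = min (mH t) (max (max c q) 1) := hGH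
  have hmG : ∀ t, 0 < mG t ↔ t ∈ G.typeCount c L := fun t => Multiset.count_pos
  have hmH : ∀ t, 0 < mH t ↔ t ∈ G.typeCount c L := fun t => by
    rw [← hmG]
    have := hGH t
    omega
  have hDG : ∀ s t, G.outDegree c L s t ≤ mG t := fun s t => by
    have : G.outDegree c L s t ≤ min (mG t) c := G.outDegree_le_count c L s t
    omega
  have hDH : ∀ s t, G.outDegree c L s t ≤ mH t := fun s t => by
    have : G.outDegree c L s t ≤ min (mG t) c := G.outDegree_le_count c L s t
    have := hGH t
    omega
  have hposG : 0 < mG (G.localType c L v) := G.count_typeCount_pos v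
  have hposH : 0 < mH (G.localType c L v) := hvw ▸ H.count_typeCount_pos w
  have key : ∀ (m m' : LocalType d c L → ℕ) (hle : m ≤ m') (_ : ∀ t, m t = m' t ∨ q ≤ m t)
      (t : LocalType d c L) (h : 0 < m t) (h' : 0 < m' t),
      φ.Sat (blowup LocalType.feat (G.outDegree c L) m ⟨_, h⟩) (blowupVertex t ⟨0, h⟩) ↔
      φ.Sat (blowup LocalType.feat (G.outDegree c L) m' ⟨_, h'⟩) (blowupVertex t ⟨0, h'⟩) := by
    intro m m' hle hmm t h h'
    refine (hq _ _ (G.outDegree_le c L) m m' ⟨_, h⟩ ⟨_, h'⟩ hle hmm (fun _ => blowupVertex t ⟨0, h⟩)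
      default).symm.trans (iff_of_eq ?_)
    exact congrArg (FirstOrder.Language.BoundedFormula.Realize φ _) (Subsingleton.elim _ _)
  have hpos : 0 < (mG ⊔ mH) (G.localType c L v) := hposG.trans_le le_sup_left
  -- Both graphs become blow-ups with the out-degrees of `G`. Each embeds into the blow-up with
  -- counts `mG ⊔ mH`: where the counts differ, both are at least `q`.
  rw [hφ.sat_iff_sat_blowup hN hG hG hmG hDG (fun _ => rfl) v hposG,
    key mG (mG ⊔ mH) le_sup_left (fun t => by
      have := hGH t
      simp only [Pi.sup_apply]
      omega) _ _ hpos] at hv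
  rw [hφ.sat_iff_sat_blowup hN hG hH hmH hDH (fun _ => rfl) w (hvw ▸ hposH)]
  refine (key mH (mG ⊔ mH) le_sup_right (fun t => by
      have := hGH t
      simp only [Pi.sup_apply]
      omega) _ _ (hvw ▸ hpos)).2 ?_
  generalize H.localType c L w = t at hvw
  subst hvw
  exact hv

end ACR

/-- Relative to first-order logic, ACR-GNNs with bounded aggregation and arbitrary readout have
exactly the power of graded modal logic with graded global modalities. The set `F` consists of the
admissible feature vectors, for instance the one-hot vectors, or all 0-1-vectors. -/
theorem mainTheorem5 (d : ℕ) (F : Set (Fin d → Bool)) (φ : ACR.FOClassifier d) :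
    (∃ N : ACR.ACRGNN d, N.HasBoundedAggregation ∧ ACR.Captures F N φ) ↔
      ∃ ψ : ACR.GMLE d, ACR.Equivalent F φ ψ := by
  constructor
  · rintro ⟨N, hN, hφ⟩
    obtain ⟨c, hc⟩ := hN.exists_isBoundedBy
    obtain ⟨K, hK⟩ := hφ.sat_of_restrict_eq hc
    obtain ⟨ψ, hψ⟩ := ACR.GMLEDefinable.exists_equiv_of_invariant c N.layers K
      (fun G => G.FeaturesIn F) (fun G v => φ.Sat G v) hK
    exact ⟨ψ, fun G hG v => hψ G v hG⟩
  · rintro ⟨ψ, hψ⟩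
    obtain ⟨N, hN, hNψ⟩ := ACR.GMLE.exists_network ψ
    exact ⟨N, hN, fun G hG v => (hNψ G v).trans (hψ G hG v).symm⟩
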